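/- Let $d\ge 4$ and $N\ge 2$ be integers, $m=\lfloor d/2\rfloor$, and let $\oplus$ denote addition modulo $d$ in $\mathbb Z_d=\{0,\dots,d-1\}$. Define subsets of $\mathbb Z_d^n$ by $\mathcal G^1_i=\{i\}$ and $\mathcal G^n_i=\bigcup_{j=0}^{d-1}\{i\oplus(d-j)\}\times\mathcal G^{n-1}_j$ for $n\ge 2$, $i\in\mathbb Z_d$. Let $T_1=\{t: 0<t<m,\ t \text{ odd}\}$, $T_2=\{0,m\}$, $T_3=T_1\cup T_2\cup\{m+1\}$, and write $\xi^{\times N}=(\xi,\dots,\xi)$. Call $\xi'\in\mathbb Z_d\setminus\{0\}$ admissible if $\xi' N\equiv 0 \pmod d$ in Case I ($d\mid N$) and in Case III ($\gcd(N,d)\neq 1$ and $d\nmid N$), and if $\xi' N\equiv m\pmod d$ in Case II ($\gcd(N,d)=1$). For an admissible $\xi'$ put - in Cases I and III: $\widetilde{\mathcal G}^N_0=\mathcal G^N_0\setminus\{0^{\times N},\xi'^{\times N}\}$ and $\widetilde{\mathcal G}^N_m=\mathcal G^N_m$; - in Case II: $\widetilde{\mathcal G}^N_0=\mathcal G^N_0\setminus\{0^{\times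 N}\}$ and $\widetilde{\mathcal G}^N_m=\mathcal G^N_m\setminus\{\xi'^{\times N}\}$; - in all cases: $\widetilde{\mathcal G}^N_t=\mathcal G^N_t$ for $t\in T_1$, and $\widetilde{\mathcal G}^N_{m+1}=\{0^{\times N},\xi'^{\times N}\}$. For $t\in T_3$ let $\tilde s_t=|\widetilde{\mathcal G}^N_t|$, let $f_t:\widetilde{\mathcal G}^N_t\to\{0,\dots,\tilde s_t-1\}$ be any bijection, and let $$\widetilde{\mathcal S}_t=\Big\{\sum_{\mathbf j\in\widetilde{\mathcal G}^N_t} e^{2\pi\sqrt{-1}\,k f_t(\mathbf j)/\tilde s_t}\,|\mathbf j\rangle \;:\; 0\le k<\tilde s_t\Big\}\subset(\mathbb C^d)^{\otimes N},\qquad \widetilde{\mathcal S}=\bigcup_{t\in T_3}\widetilde{\mathcal S}_t$$ (states are not normalized). Then an admissible $\xi'$ exists, and for every admissible $\xi'$ and every choice of the bijections $f_t$ the following hold. 1. $\widetilde{\mathcal S}$ is an orthogonal genuinely entangled set: its elements are pairwise orthogonal, nonzero, and none of them is a product state across any bipartition of the $N$ parties. 2. $\widetilde{\mathcal S}$ has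 the strongest nonlocality: for each nonempty proper subset $A$ of the parties, every POVM $\{E_x\}$ on the joint system of $A$ that preserves orthogonality (that is, $\langle\varphi|E_x\otimes\mathbb I|\psi\rangle=0$ for all outcomes $x$ and all different $\varphi,\psi\in\widetilde{\mathcal S}$) is trivial, i.e. each $E_x$ is proportional to the identity. 3. $|\widetilde{\mathcal S}|=\big(\frac{m+1}{2}+1\big)d^{N-1}$ if $m$ is odd, and $|\widetilde{\mathcal S}|=\big(\frac{m}{2}+2\big)d^{N-1}$ if $m$ is even. -/

import Mathlib

namespace OGES

/-- Strings in `ℤ_d^N`, the labels of the computational basis of `(ℂ^d)^{⊗N}`. -/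
abbrev Str (d N : ℕ) : Type := Fin N → ZMod d

/-- The Hilbert space `(ℂ^d)^{⊗N}`, in coordinates with respect to the computational basis
`|j₁ j₂ … j_N⟩`, `j ∈ ℤ_d^N`; vectors are not normalized. -/
abbrev Hilb (d N : ℕ) : Type := EuclideanSpace ℂ (Str d N)

section Nonlocality

open scoped ComplexOrder

variable {d N : ℕ} [NeZero d]

/-- The operator `E ⊗ 𝟙` on `(ℂ^d)^{⊗N}`, where `E` acts on the joint system of the parties in `A`
and the identity acts on all other parties. -/
def localOp (A : Finset (Fin N)) (E : Matrix (A → ZMod d) (A → ZMod d) ℂ) :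
    Matrix (Str d N) (Str d N) ℂ :=
  Matrix.of fun x y =>
    if ∀ i, i ∉ A → x i = y i then E (fun i => x i) (fun i => y i) else 0

/-- A POVM with finitely many outcomes: positive semidefinite operators that sum to `𝟙`. -/
structure IsPOVM {κ : Type*} [Fintype κ] [DecidableEq κ] {n : ℕ} (E : Fin n → Matrix κ κ ℂ) :
    Prop where
  posSemidef : ∀ m, (E m).PosSemidef
  sum_eq_one : ∑ m, E m = 1

/-- A local measurement `E` of the parties in `A` preserves the orthogonality of the set `S`: after
each outcome, different states of `S` are still orthogonal, `⟨φ| E_m ⊗ 𝟙 |ψ⟩ = 0`. -/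
def PreservesOrthogonality (S : Set (Hilb d N)) (A : Finset (Fin N)) {n : ℕ}
    (E : Fin n → Matrix (A → ZMod d) (A → ZMod d) ℂ) : Prop :=
  ∀ m, ∀ φ ∈ S, ∀ ψ ∈ S, φ ≠ ψ →
    inner ℂ φ (Matrix.toEuclideanLin (localOp A (E m)) ψ) = 0

/-- A measurement is trivial if all its operators are proportional to the identity. -/
def IsTrivialMeasurement {κ : Type*} [DecidableEq κ] {n : ℕ} (E : Fin n → Matrix κ κ ℂ) : Prop :=
  ∀ m, ∃ c : ℂ, E m = c • (1 : Matrix κ κ ℂ)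

/-- Strongest nonlocality: for each bipartition `A | Aᶜ` of the parties, each side can perform only
trivial orthogonality-preserving POVMs. (Both sides of a bipartition occur as `A`.) -/
def HasStrongestNonlocality (S : Set (Hilb d N)) : Prop :=
  ∀ A : Finset (Fin N), A.Nonempty → A ≠ Finset.univ →
    ∀ (n : ℕ) (E : Fin n → Matrix (A → ZMod d) (A → ZMod d) ℂ),
      IsPOVM E → PreservesOrthogonality S A E → IsTrivialMeasurement E

/-- The state `ψ` is a product state `|α⟩_A ⊗ |β⟩_{Aᶜ}` across the bipartition `A | Aᶜ`. -/
def IsProductAcross (A : Finset (Fin N)) (ψ : Hilb d N) : Prop :=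
  ∃ (α : (A → ZMod d) → ℂ) (β : ({i // i ∉ A} → ZMod d) → ℂ),
    ∀ x : Str d N, ψ x = α (fun i => x i) * β (fun i => x i)

/-- A (pure) state is genuinely entangled if it is nonzero and is not a product state across any
bipartition of the parties. -/
def IsGenuinelyEntangled (ψ : Hilb d N) : Prop :=
  ψ ≠ 0 ∧ ∀ A : Finset (Fin N), A.Nonempty → A ≠ Finset.univ → ¬ IsProductAcross A ψ

/-- An orthogonal genuinely entangled set: genuinely entangled, pairwise orthogonal states. -/
def IsOGES (S : Set (Hilb d N)) : Prop :=
  (∀ ψ ∈ S, IsGenuinelyEntangled ψ) ∧ S.Pairwise fun φ ψ => inner ℂ φ ψ = 0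

end Nonlocality

section Construction

variable (d : ℕ) [NeZero d]

/-- The sets `𝒢^N_i`: `𝒢^1_i = {i}` and `𝒢^N_i = ⋃_j {i ⊕ (d - j)} × 𝒢^{N-1}_j` for `N ≥ 2`, with
addition modulo `d`. The value at `N = 0` is not used. -/
def G : (N : ℕ) → ZMod d → Finset (Str d N)
  | 0, _ => ∅
  | 1, i => {fun _ => i}
  | N + 2, i => Finset.univ.biUnion fun j : ZMod d =>
      (G (N + 1) j).image fun x : Str d (N + 1) => (Fin.cons (i - j) x : Str d (N + 2))

/-- `T₁ = {t : 0 < t < ⌊d/2⌋, t odd}`. -/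
def T₁ : Finset ℕ := (Finset.range (d / 2)).filter fun t => Odd t

/-- `T₂ = {0, ⌊d/2⌋}`. -/
def T₂ : Finset ℕ := {0, d / 2}

/-- `T₃ = T₁ ∪ T₂ ∪ {⌊d/2⌋ + 1}`. -/
def T₃ : Finset ℕ := T₁ d ∪ T₂ d ∪ {d / 2 + 1}

variable (N : ℕ)

/-- The condition on the element `ξ ∈ ℤ_d \ {0}`: if `N` is coprime to `d` (Case II), then
`ξ N ≡ ⌊d/2⌋` modulo `d`; otherwise (Case I: `N ≡ 0` modulo `d`, and Case III), `ξ N ≡ 0`. -/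
def Admissible (ξ : ZMod d) : Prop :=
  ξ ≠ 0 ∧ if N.Coprime d then ξ * (N : ZMod d) = ((d / 2 : ℕ) : ZMod d) else ξ * (N : ZMod d) = 0

/-- The modified sets `𝒢̃^N_t`, `t ∈ T₃`. The constant strings `0^N` and `ξ^N` are moved to the new
set with index `⌊d/2⌋ + 1`. The string `0^N` is taken from `𝒢^N_0`; the string `ξ^N` is taken from
`𝒢^N_{⌊d/2⌋}` if `N` is coprime to `d` (Case II), and from `𝒢^N_0` otherwise (Cases I and III). -/
def tildeG (ξ : ZMod d) (t : ℕ) : Finset (Str d N) :=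
  if t = 0 then
    if N.Coprime d then G d N 0 \ {fun _ => 0} else G d N 0 \ {fun _ => 0, fun _ => ξ}
  else if t = d / 2 then
    if N.Coprime d then G d N ((d / 2 : ℕ) : ZMod d) \ {fun _ => ξ}
    else G d N ((d / 2 : ℕ) : ZMod d)
  else if t = d / 2 + 1 then {fun _ => 0, fun _ => ξ}
  else G d N (t : ZMod d)

variable {d N}

/-- For a set `B` of basis strings, `s = |B|`, and a bijection `f : B → ℤ_s`, the state
`∑_{j ∈ B} ω_s^{k f(j)} |j⟩` with `ω_s = exp (2 π √-1 / s)`. -/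
noncomputable def fourierState (B : Finset (Str d N)) (f : B ≃ Fin B.card) (k : Fin B.card) :
    Hilb d N :=
  ∑ j : B, Complex.exp (2 * Real.pi * Complex.I / B.card) ^ ((k : ℕ) * (f j : ℕ)) •
    EuclideanSpace.single (j : Str d N) (1 : ℂ)

/-- `S̃_t`, the set of the states `|Ψ̃_{t,k}⟩` with `k ∈ ℤ_{s̃_t}`. -/
def tildeSBlock (ξ : ZMod d) (t : ℕ) (f : tildeG d N ξ t ≃ Fin (tildeG d N ξ t).card) :
    Set (Hilb d N) :=
  Set.range (fourierState (tildeG d N ξ t) f)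

/-- `S̃ = ⋃_{t ∈ T₃} S̃_t`, for a family of bijections `f_t : 𝒢̃^N_t → ℤ_{s̃_t}`. -/
def tildeS (ξ : ZMod d) (f : ∀ t : T₃ d, tildeG d N ξ t ≃ Fin (tildeG d N ξ t).card) :
    Set (Hilb d N) :=
  ⋃ t : T₃ d, tildeSBlock ξ t (f t)

end Construction

end OGES

namespace OGES

/-! By `mem_G`, the recursive sets are the classes of strings with prescribed coordinate sum. Each
constant string `0^N`, `ξ^N` has its sum in `T₁ ∪ T₂`, so the modified sets only repartition the
strings whose sum lies there: one class minus the two constants for each such sum, plus the pair of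
constants (`tildeG_eq_sdiff`). This gives the orthogonality of different blocks and the count.

The support of a product state is closed under exchanging the `A`-parts of two strings. Exchanging
parts with different partial sums leaves a sum class, and mixing `0^N` with `ξ^N` gives a
nonconstant string, so no state is a product.

For nonlocality, let `M = E ⊗ 𝟙`. The Fourier states over a set span all vectors supported on it, so
`M` vanishes between different blocks. If `a`, `b` on `A` have different sums, then
`exists_difference` lets a common extension outside `A` put them in different blocks, whence `E a b
= 0`. Isolating `0^N` from the sum-zero class makes the zero row of `E` diagonal even among equal
sums. Finally, `M` is diagonal in the Fourier basis of the sum-one class and has a diagonal row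
there, so it is scalar on that class (`eq_scalar_of_fourier_diagonal`). Any two `a`, `b` with equal
sums extend into this class, so `E` is scalar. -/

open Finset ComplexConjugate

/-! ### Orthogonality of the discrete Fourier vectors -/

section Fourier

/-- The primitive root of unity `exp (2 π √-1 / s)`. -/
noncomputable def rootOfUnity (s : ℕ) : ℂ := Complex.exp (2 * Real.pi * Complex.I / s)

theorem rootOfUnity_ne_zero (s : ℕ) : rootOfUnity s ≠ 0 := Complex.exp_ne_zero _

theorem isPrimitiveRoot_rootOfUnity {s : ℕ} (hs : s ≠ 0) :
    IsPrimitiveRoot (rootOfUnity s) s := Complex.isPrimitiveRoot_exp s hs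

theorem conj_rootOfUnity (s : ℕ) : conj (rootOfUnity s) = (rootOfUnity s)⁻¹ := by
  rw [rootOfUnity, ← Complex.exp_conj, ← Complex.exp_neg]
  congr 1
  simp [neg_div, Complex.conj_ofNat]

theorem sum_conj_rootOfUnity_pow_mul {s : ℕ} (a b : Fin s) :
    ∑ k : Fin s, conj (rootOfUnity s ^ ((k : ℕ) * (a : ℕ))) * rootOfUnity s ^ ((k : ℕ) * (b : ℕ))
      = if a = b then (s : ℂ) else 0 := by
  have hs : s ≠ 0 := fun h => by subst h; exact a.elim0
  have hw := rootOfUnity_ne_zero s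
  set ω := rootOfUnity s with hω
  have key : ∀ k : ℕ, conj (ω ^ (k * (a : ℕ))) * ω ^ (k * (b : ℕ))
      = ((ω ^ (a : ℕ))⁻¹ * ω ^ (b : ℕ)) ^ k := by
    intro k
    rw [map_pow, hω, conj_rootOfUnity, ← hω, mul_pow, ← inv_pow, ← pow_mul, ← pow_mul,
      mul_comm k, mul_comm k]
  simp only [key]
  rw [Fin.sum_univ_eq_sum_range (fun k => ((ω ^ (a : ℕ))⁻¹ * ω ^ (b : ℕ)) ^ k)]
  split_ifs with hab
  · subst hab
    rw [inv_mul_cancel₀ (pow_ne_zero _ hw)]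
    simp
  · have hne : (ω ^ (a : ℕ))⁻¹ * ω ^ (b : ℕ) ≠ 1 := by
      intro h
      rw [inv_mul_eq_one₀ (pow_ne_zero _ hw)] at h
      exact hab (Fin.ext ((isPrimitiveRoot_rootOfUnity hs).pow_inj a.2 b.2 h))
    rw [geom_sum_eq hne, mul_pow, inv_pow, ← pow_mul, ← pow_mul, mul_comm (a : ℕ),
      mul_comm (b : ℕ), pow_mul, pow_mul, (isPrimitiveRoot_rootOfUnity hs).pow_eq_one]
    simp

theorem sum_conj_rootOfUnity_pow_equiv {ι : Type*} [Fintype ι] {s : ℕ} (f : ι ≃ Fin s)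
    (k l : Fin s) :
    ∑ j, conj (rootOfUnity s ^ ((k : ℕ) * (f j : ℕ))) * rootOfUnity s ^ ((l : ℕ) * (f j : ℕ))
      = if k = l then (s : ℂ) else 0 := by
  rw [← sum_conj_rootOfUnity_pow_mul k l, ← f.sum_comp]
  simp only [mul_comm]

/-- A vector orthogonal to all Fourier vectors is zero. -/
theorem eq_zero_of_forall_fourier {ι : Type*} [Fintype ι] {s : ℕ} (f : ι ≃ Fin s) (w : ι → ℂ)
    (h : ∀ k : Fin s, ∑ j, conj (rootOfUnity s ^ ((k : ℕ) * (f j : ℕ))) * w j = 0) : w = 0 := by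
  classical
  funext i
  have hs : (s : ℂ) ≠ 0 := by
    have := (f i).pos
    exact_mod_cast this.ne'
  have h1 : ∑ k : Fin s, rootOfUnity s ^ ((k : ℕ) * (f i : ℕ)) *
      ∑ j, conj (rootOfUnity s ^ ((k : ℕ) * (f j : ℕ))) * w j = 0 := 
    sum_eq_zero fun k _ => by rw [h, mul_zero]
  simp only [mul_sum] at h1
  rw [sum_comm] at h1
  have h2 : ∀ j, ∑ k : Fin s, rootOfUnity s ^ ((k : ℕ) * (f i : ℕ)) *
      (conj (rootOfUnity s ^ ((k : ℕ) * (f j : ℕ))) * w j) = if j = i then s * w j else 0 := by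
    intro j
    have := sum_conj_rootOfUnity_pow_mul (f j) (f i)
    simp only [f.injective.eq_iff] at this
    rw [← ite_zero_mul, ← this, sum_mul]
    exact sum_congr rfl fun k _ => by ring
  simp only [h2, sum_ite_eq', mem_univ, if_true] at h1
  simpa [hs] using h1

theorem eq_zero_of_forall_fourier' {ι : Type*} [Fintype ι] {s : ℕ} (f : ι ≃ Fin s) (w : ι → ℂ)
    (h : ∀ k : Fin s, ∑ j, w j * rootOfUnity s ^ ((k : ℕ) * (f j : ℕ)) = 0) : w = 0 := by
  have := eq_zero_of_forall_fourier f (fun j => conj (w j)) fun k => by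
    have := congrArg conj (h k)
    rw [map_sum, map_zero] at this
    rw [← this]
    exact sum_congr rfl fun j _ => by rw [map_mul, mul_comm]
  funext j
  simpa using congrFun this j

/-- A matrix that is diagonal in the Fourier basis and has a diagonal row is a scalar matrix. -/
theorem eq_scalar_of_fourier_diagonal {ι : Type*} [Fintype ι] [DecidableEq ι] {s : ℕ}
    (f : ι ≃ Fin s) (M : ι → ι → ℂ)
    (h : ∀ k l : Fin s, k ≠ l → ∑ x, conj (rootOfUnity s ^ ((k : ℕ) * (f x : ℕ))) *
      ∑ y, M x y * rootOfUnity s ^ ((l : ℕ) * (f y : ℕ)) = 0)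
    (i : ι) (hi : ∀ y, y ≠ i → M i y = 0) (x y : ι) :
    M x y = if x = y then M i i else 0 := by
  have hs : (s : ℂ) ≠ 0 := by
    have := (f i).pos
    exact_mod_cast this.ne'
  set c := M i i
  have hrow : ∀ x, ∀ l : Fin s, ∑ y, (M x y - if x = y then c else 0) *
      rootOfUnity s ^ ((l : ℕ) * (f y : ℕ)) = (∑ y, M x y * rootOfUnity s ^ ((l : ℕ) * (f y : ℕ)))
        - c * rootOfUnity s ^ ((l : ℕ) * (f x : ℕ)) := by
    intro x l
    simp [sub_mul, sum_sub_distrib, ite_mul]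
  have hrowi : ∀ l : Fin s, ∑ y, (M i y - if i = y then c else 0) *
      rootOfUnity s ^ ((l : ℕ) * (f y : ℕ)) = 0 := by
    intro l
    refine sum_eq_zero fun y _ => ?_
    by_cases hy : i = y
    · subst hy; simp [c]
    · simp [hy, hi y (Ne.symm hy)]
  suffices hz : ∀ x, (fun y => M x y - if x = y then c else 0) = 0 by
    exact sub_eq_zero.mp (congrFun (hz x) y)
  intro x
  apply eq_zero_of_forall_fourier' f
  intro l
  revert x
  set v : ι → ℂ := fun x => ∑ y, (M x y - if x = y then c else 0) *
    rootOfUnity s ^ ((l : ℕ) * (f y : ℕ)) with hv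
  have hk : ∀ k, k ≠ l → ∑ x, conj (rootOfUnity s ^ ((k : ℕ) * (f x : ℕ))) * v x = 0 := by
    intro k hkl
    simp only [hv, hrow, mul_sub, sum_sub_distrib]
    rw [h k l hkl, zero_sub, neg_eq_zero]
    have := sum_conj_rootOfUnity_pow_equiv f k l
    rw [if_neg hkl] at this
    rw [← mul_zero c, ← this, mul_sum]
    exact sum_congr rfl fun x _ => by ring
  -- Being orthogonal to all Fourier vectors except the `l`-th, `v` is `α` times that one. Its entry
  -- at `i` is zero, while Fourier vectors have no zero entry, so `α = 0`.
  set α := (∑ x, conj (rootOfUnity s ^ ((l : ℕ) * (f x : ℕ))) * v x) / s with hα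
  have hw := eq_zero_of_forall_fourier f
    (fun x => v x - α * rootOfUnity s ^ ((l : ℕ) * (f x : ℕ))) fun k => by
      have e : ∑ x, conj (rootOfUnity s ^ ((k : ℕ) * (f x : ℕ))) *
          (α * rootOfUnity s ^ ((l : ℕ) * (f x : ℕ))) = α * if k = l then (s : ℂ) else 0 := by
        rw [← sum_conj_rootOfUnity_pow_equiv f k l, mul_sum]
        exact sum_congr rfl fun x _ => by ring
      simp only [mul_sub, sum_sub_distrib]
      rw [e]
      by_cases hkl : k = l
      · subst hkl
        rw [if_pos rfl, hα, div_mul_cancel₀ _ hs, sub_self]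
      · rw [hk k hkl, if_neg hkl]; simp
  have hvx : ∀ x, v x = α * rootOfUnity s ^ ((l : ℕ) * (f x : ℕ)) := fun x =>
    sub_eq_zero.mp (congrFun hw x)
  have hα0 : α = 0 := by
    have h1 := hvx i
    have h2 : v i = 0 := hrowi l
    rw [h2] at h1
    exact (mul_eq_zero.mp h1.symm).resolve_right (pow_ne_zero _ (rootOfUnity_ne_zero s))
  intro x
  have := hvx x
  rw [hα0, zero_mul] at this
  exact this

end Fourier

/-! ### Fourier states over a set of strings -/

section FourierState

variable {d N : ℕ} [NeZero d]

omit [NeZero d] in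
theorem fourierState_apply (B : Finset (Str d N)) (f : B ≃ Fin B.card) (k : Fin B.card)
    (x : Str d N) :
    fourierState B f k x =
      if h : x ∈ B then rootOfUnity B.card ^ ((k : ℕ) * (f ⟨x, h⟩ : ℕ)) else 0 := by
  have : fourierState B f k x = ∑ j : B, if x = (j : Str d N) then
      rootOfUnity B.card ^ ((k : ℕ) * (f j : ℕ)) else 0 := by
    simp [fourierState, rootOfUnity, Finset.sum_apply, Pi.single_apply]
  rw [this]
  split_ifs with h
  · rw [sum_eq_single ⟨x, h⟩]
    · simp
    · intro b _ hb
      rw [if_neg]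
      rintro rfl
      exact hb rfl
    · simp
  · refine sum_eq_zero fun j _ => if_neg ?_
    rintro rfl
    exact h j.2

omit [NeZero d] in
theorem fourierState_apply_coe (B : Finset (Str d N)) (f : B ≃ Fin B.card) (k : Fin B.card)
    (x : B) : fourierState B f k x = rootOfUnity B.card ^ ((k : ℕ) * (f x : ℕ)) := by
  rw [fourierState_apply, dif_pos x.2]

omit [NeZero d] in
theorem fourierState_apply_of_notMem {B : Finset (Str d N)} (f : B ≃ Fin B.card)
    (k : Fin B.card) {x : Str d N} (hx : x ∉ B) : fourierState B f k x = 0 := by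
  rw [fourierState_apply, dif_neg hx]

omit [NeZero d] in
theorem fourierState_apply_ne_zero_iff {B : Finset (Str d N)} (f : B ≃ Fin B.card)
    (k : Fin B.card) {x : Str d N} : fourierState B f k x ≠ 0 ↔ x ∈ B := by
  refine ⟨fun h => ?_, fun h => ?_⟩
  · by_contra hx
    exact h (fourierState_apply_of_notMem f k hx)
  · rw [fourierState_apply, dif_pos h]
    exact pow_ne_zero _ (rootOfUnity_ne_zero _)

omit [NeZero d] in
theorem fourierState_ne_zero {B : Finset (Str d N)} (f : B ≃ Fin B.card) (k : Fin B.card) :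
    fourierState B f k ≠ 0 := by
  intro h
  apply (fourierState_apply_ne_zero_iff f k).mpr (f.symm k).2
  rw [h]
  rfl

theorem inner_fourierState_left (B : Finset (Str d N)) (f : B ≃ Fin B.card) (k : Fin B.card)
    (ψ : Hilb d N) : inner ℂ (fourierState B f k) ψ =
      ∑ x : B, conj (rootOfUnity B.card ^ ((k : ℕ) * (f x : ℕ))) * ψ x := by
  rw [PiLp.inner_apply]
  simp only [RCLike.inner_apply']
  rw [← sum_subset (subset_univ B), ← sum_coe_sort B]
  · simp only [fourierState_apply_coe]
  · intro x _ hx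
    rw [fourierState_apply_of_notMem f k hx]
    simp

theorem toEuclideanLin_fourierState_apply (M : Matrix (Str d N) (Str d N) ℂ)
    (B : Finset (Str d N)) (f : B ≃ Fin B.card) (k : Fin B.card) (x : Str d N) :
    Matrix.toEuclideanLin M (fourierState B f k) x =
      ∑ y : B, M x y * rootOfUnity B.card ^ ((k : ℕ) * (f y : ℕ)) := by
  have : Matrix.toEuclideanLin M (fourierState B f k) x = ∑ y, M x y * fourierState B f k y := by
    rfl
  rw [this, ← sum_subset (subset_univ B), ← sum_coe_sort B]
  · simp only [fourierState_apply_coe]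
  · intro x _ hx
    rw [fourierState_apply_of_notMem f k hx]
    simp

theorem inner_fourierState_of_ne (B : Finset (Str d N)) (f : B ≃ Fin B.card) {k l : Fin B.card}
    (h : k ≠ l) : inner ℂ (fourierState B f k) (fourierState B f l) = 0 := by
  rw [inner_fourierState_left]
  simp only [fourierState_apply_coe]
  rw [sum_conj_rootOfUnity_pow_equiv, if_neg h]

theorem inner_fourierState_of_disjoint {B C : Finset (Str d N)} (h : Disjoint B C)
    (f : B ≃ Fin B.card) (g : C ≃ Fin C.card) (k : Fin B.card) (l : Fin C.card) :
    inner ℂ (fourierState B f k) (fourierState C g l) = 0 := by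
  rw [inner_fourierState_left]
  refine sum_eq_zero fun x _ => ?_
  rw [fourierState_apply_of_notMem g l (disjoint_left.mp h x.2), mul_zero]

/-- If `M` maps no state over `C` to a vector overlapping a state over `B`, then its block
with rows `B` and columns `C` vanishes. -/
theorem apply_eq_zero_of_inner_fourierState {M : Matrix (Str d N) (Str d N) ℂ}
    {B C : Finset (Str d N)} (f : B ≃ Fin B.card) (g : C ≃ Fin C.card)
    (h : ∀ k l, inner ℂ (fourierState B f k)
      (Matrix.toEuclideanLin M (fourierState C g l)) = 0)
    {x y : Str d N} (hx : x ∈ B) (hy : y ∈ C) : M x y = 0 := by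
  have h1 : ∀ l, (fun x : B => Matrix.toEuclideanLin M (fourierState C g l) x) = 0 := fun l =>
    eq_zero_of_forall_fourier f _ fun k => by rw [← inner_fourierState_left, h]
  have h2 := eq_zero_of_forall_fourier' g (fun y : C => M x y) fun l => by
    rw [← toEuclideanLin_fourierState_apply]
    exact congrFun (h1 l) ⟨x, hx⟩
  exact congrFun h2 ⟨y, hy⟩

/-- One diagonal row turns a block that is diagonal in the Fourier basis into a scalar block. -/
theorem apply_eq_scalar_of_inner_fourierState {M : Matrix (Str d N) (Str d N) ℂ}
    {B : Finset (Str d N)} (f : B ≃ Fin B.card)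
    (h : ∀ k l, k ≠ l → inner ℂ (fourierState B f k)
      (Matrix.toEuclideanLin M (fourierState B f l)) = 0)
    {z : Str d N} (hz : z ∈ B) (hrow : ∀ y, y ≠ z → M z y = 0)
    {x y : Str d N} (hx : x ∈ B) (hy : y ∈ B) : M x y = if x = y then M z z else 0 := by
  have := eq_scalar_of_fourier_diagonal f (fun x y : B => M x y) (fun k l hkl => by
    rw [← h k l hkl, inner_fourierState_left]
    simp only [toEuclideanLin_fourierState_apply]) ⟨z, hz⟩
    (fun y hy => hrow y fun e => hy (Subtype.ext e)) ⟨x, hx⟩ ⟨y, hy⟩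
  simpa using this

end FourierState

/-! ### Coordinate sums and the modified classes -/

section Combinatorics

variable {d N : ℕ} [NeZero d]

theorem mem_G_succ (n : ℕ) (i : ZMod d) (x : Str d (n + 1)) : x ∈ G d (n + 1) i ↔ ∑ j, x j = i := by
  induction n generalizing i with
  | zero =>
    simp only [G, mem_singleton]
    refine ⟨fun h => by simp [h], fun h => ?_⟩
    rw [← h]
    funext j
    rw [Fin.sum_univ_one, Fin.fin_one_eq_zero j]
  | succ n ih =>
    simp only [G, mem_biUnion, mem_univ, true_and, mem_image]
    constructor
    · rintro ⟨j, y, hy, rfl⟩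
      rw [ih] at hy
      rw [Fin.sum_univ_succ]
      simp [hy]
    · intro h
      refine ⟨∑ j, Fin.tail x j, Fin.tail x, (ih _ _).mpr rfl, ?_⟩
      rw [← h, Fin.sum_univ_succ]
      have : x 0 + ∑ j : Fin (n + 1), x j.succ - ∑ j, Fin.tail x j = x 0 := by
        simp [Fin.tail]
      rw [this, Fin.cons_self_tail]

theorem mem_G (hN : N ≠ 0) {i : ZMod d} {x : Str d N} : x ∈ G d N i ↔ ∑ j, x j = i := by
  obtain ⟨n, rfl⟩ := Nat.exists_eq_succ_of_ne_zero hN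
  exact mem_G_succ n i x

theorem card_G (hN : N ≠ 0) (i : ZMod d) : (G d N i).card = d ^ (N - 1) := by
  obtain ⟨n, rfl⟩ := Nat.exists_eq_succ_of_ne_zero hN
  have : (univ : Finset (Fin n → ZMod d)).card = d ^ n := by
    simp [ZMod.card]
  rw [Nat.succ_sub_one, ← this]
  -- The prescribed sum determines the first coordinate from the others.
  refine card_nbij' (fun x => Fin.tail x) (fun y => Fin.cons (i - ∑ j, y j) y) ?_ ?_ ?_ ?_
  · intro x _; simp
  · intro y _
    simp [mem_G_succ, Fin.sum_univ_succ]
  · intro x hx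
    have hx' := (mem_G_succ n i x).mp hx
    rw [Fin.sum_univ_succ] at hx'
    have : i - ∑ j, Fin.tail x j = x 0 := by
      rw [← hx']; simp [Fin.tail]
    simp only [this, Fin.cons_self_tail]
  · intro y _
    simp

theorem card_filter_odd_range (m : ℕ) : ((range m).filter fun t => Odd t).card = m / 2 := by
  induction m with
  | zero => simp
  | succ m ih =>
    rw [range_add_one, filter_insert]
    split_ifs with h
    · rw [card_insert_of_notMem (by simp), ih]
      obtain ⟨k, rfl⟩ := h
      omega
    · rw [ih]
      rw [Nat.not_odd_iff_even] at h
      obtain ⟨k, rfl⟩ := h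
      omega

omit [NeZero d] in
theorem mem_T₁_union_T₂ {t : ℕ} :
    t ∈ T₁ d ∪ T₂ d ↔ (t < d / 2 ∧ Odd t) ∨ t = 0 ∨ t = d / 2 := by
  simp only [T₁, T₂, mem_union, mem_filter, mem_range, mem_insert, mem_singleton]

omit [NeZero d] in
theorem mem_T₃ {t : ℕ} : t ∈ T₃ d ↔ t ∈ T₁ d ∪ T₂ d ∨ t = d / 2 + 1 := by
  simp only [T₃, mem_union, mem_singleton]

omit [NeZero d] in
theorem zero_mem_T₁_union_T₂ : 0 ∈ T₁ d ∪ T₂ d := mem_T₁_union_T₂.mpr (.inr (.inl rfl))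

omit [NeZero d] in
theorem half_mem_T₁_union_T₂ : d / 2 ∈ T₁ d ∪ T₂ d := mem_T₁_union_T₂.mpr (.inr (.inr rfl))

omit [NeZero d] in
theorem le_of_mem_T₁_union_T₂ {t : ℕ} (h : t ∈ T₁ d ∪ T₂ d) : t ≤ d / 2 := by
  rw [mem_T₁_union_T₂] at h
  omega

omit [NeZero d] in
theorem card_T₁_union_T₂ (hd : 4 ≤ d) : (T₁ d ∪ T₂ d).card = d / 2 / 2 + 2 := by
  rw [card_union_of_disjoint, T₁, card_filter_odd_range, T₂, card_pair (by omega)]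
  rw [disjoint_left]
  intro t h1 h2
  simp only [T₁, mem_filter, mem_range] at h1
  simp only [T₂, mem_insert, mem_singleton] at h2
  rcases h2 with rfl | h2
  · simp at h1
  · omega

omit [NeZero d] in
theorem natCast_zmod_injOn {s t : ℕ} (hs : s < d) (ht : t < d)
    (h : (s : ZMod d) = (t : ZMod d)) : s = t := by
  rw [ZMod.natCast_eq_natCast_iff'] at h
  rwa [Nat.mod_eq_of_lt hs, Nat.mod_eq_of_lt ht] at h

theorem natCast_ne_of_mem {s t : ℕ} (hs : s ∈ T₁ d ∪ T₂ d) (ht : t ∈ T₁ d ∪ T₂ d)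
    (h : s ≠ t) : (s : ZMod d) ≠ (t : ZMod d) := by
  have h1 := le_of_mem_T₁_union_T₂ hs
  have h2 := le_of_mem_T₁_union_T₂ ht
  have h3 := NeZero.ne d
  exact fun e => h (natCast_zmod_injOn (by omega) (by omega) e)

omit [NeZero d] in
/-- Every difference of at most `⌊d/2⌋` occurs in `T₁ ∪ T₂`. -/
theorem exists_nat_difference {e : ℕ} (h0 : 0 < e) (h : e ≤ d / 2) :
    ∃ s ∈ T₁ d ∪ T₂ d, ∃ t ∈ T₁ d ∪ T₂ d, s = t + e := by
  simp only [mem_T₁_union_T₂]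
  rcases Nat.lt_or_ge e (d / 2) with h1 | h1
  · rcases Nat.even_or_odd e with he | he
    · rcases Nat.even_or_odd (d / 2) with hm | hm
      -- For `e` and `d / 2` both even, `e < d / 2` leaves a gap of two, so `1 + e` is still in
      -- `T₁`.
      · refine ⟨1 + e, .inl ⟨?_, ?_⟩, 1, .inl ⟨by omega, odd_one⟩, rfl⟩
        · obtain ⟨a, ha⟩ := he
          obtain ⟨b, hb⟩ := hm
          omega
        · exact odd_one.add_even he
      · exact ⟨d / 2, by simp, d / 2 - e, .inl ⟨by omega, Nat.Odd.sub_even h1.le hm he⟩, by omega⟩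
    · exact ⟨e, .inl ⟨h1, he⟩, 0, by simp, by simp⟩
  · exact ⟨d / 2, by simp, 0, by simp, by omega⟩

/-- Every nonzero element of `ℤ_d` is a difference of two elements of `T₁ ∪ T₂`. -/
theorem exists_difference {δ : ZMod d} (h : δ ≠ 0) :
    ∃ s ∈ T₁ d ∪ T₂ d, ∃ t ∈ T₁ d ∪ T₂ d, s ≠ t ∧ (s : ZMod d) - t = δ := by
  have hv : δ.val < d := ZMod.val_lt δ
  have hv0 : 0 < δ.val := ZMod.val_pos.mpr h
  rcases Nat.lt_or_ge (d / 2) δ.val with h1 | h1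
  -- A representative above `d / 2` is handled through its negative, with the two elements
  -- exchanged.
  · obtain ⟨s, hs, t, ht, e⟩ := exists_nat_difference (d := d) (e := d - δ.val) (by omega) (by omega)
    refine ⟨t, ht, s, hs, by omega, ?_⟩
    rw [e, Nat.cast_add, Nat.cast_sub hv.le]
    simp
  · obtain ⟨s, hs, t, ht, e⟩ := exists_nat_difference (d := d) hv0 h1
    refine ⟨s, hs, t, ht, by omega, ?_⟩
    rw [e]
    simp

/-- The two constant strings `0^N` and `ξ^N`. -/
def constPair (N : ℕ) (ξ : ZMod d) : Finset (Str d N) := {fun _ => 0, fun _ => ξ}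

omit [NeZero d] in
theorem mem_constPair {ξ : ZMod d} {x : Str d N} :
    x ∈ constPair N ξ ↔ x = (fun _ => 0) ∨ x = fun _ => ξ := by
  simp [constPair]

omit [NeZero d] in
theorem half_ne_zero (hd : 4 ≤ d) : ((d / 2 : ℕ) : ZMod d) ≠ 0 := by
  intro h
  have := natCast_zmod_injOn (d := d) (s := d / 2) (t := 0) (by omega) (by omega) (by simpa using h)
  omega

omit [NeZero d] in
theorem exists_admissible (hd : 4 ≤ d) : ∃ ξ : ZMod d, Admissible d N ξ := by
  unfold Admissible
  split_ifs with h
  · have hu : ((N : ZMod d)⁻¹) * N = 1 := by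
      rw [mul_comm]; exact ZMod.coe_mul_inv_eq_one N h
    have e : ((d / 2 : ℕ) : ZMod d) * (N : ZMod d)⁻¹ * N = ((d / 2 : ℕ) : ZMod d) := by
      rw [mul_assoc, hu, mul_one]
    refine ⟨_, fun h0 => half_ne_zero hd ?_, e⟩
    rw [← e, h0, zero_mul]
  · have hg : 1 < N.gcd d := by
      have : N.gcd d ≠ 0 := Nat.gcd_ne_zero_right (by omega)
      have : N.gcd d ≠ 1 := h
      omega
    have hgd : N.gcd d ≤ d := Nat.gcd_le_right _ (by omega)
    refine ⟨((d / N.gcd d : ℕ) : ZMod d), ?_, ?_⟩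
    · intro h0
      rw [ZMod.natCast_eq_zero_iff] at h0
      have h1 : 0 < d / N.gcd d := Nat.div_pos hgd (by omega)
      have h2 : d / N.gcd d < d := Nat.div_lt_self (by omega) hg
      exact absurd (Nat.le_of_dvd h1 h0) (by omega)
    · rw [← Nat.cast_mul, ZMod.natCast_eq_zero_iff]
      obtain ⟨a, ha⟩ := Nat.gcd_dvd_left N d
      refine ⟨a, ?_⟩
      conv_lhs => rw [ha]
      rw [← mul_assoc]
      congr 1
      rw [← ha]
      exact Nat.div_mul_cancel (Nat.gcd_dvd_right N d)

variable {ξ : ZMod d}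

omit [NeZero d] in
theorem sum_const_admissible (hξ : Admissible d N ξ) :
    ∑ _j : Fin N, ξ = if N.Coprime d then ((d / 2 : ℕ) : ZMod d) else 0 := by
  have h := hξ.2
  rw [sum_const, card_univ, Fintype.card_fin, nsmul_eq_mul, mul_comm]
  split_ifs at h ⊢ <;> exact h

/-- Deleting both constants from every class is harmless, since each lies only in the class of its
own sum. This removes the case distinction from all later arguments. -/
theorem tildeG_eq_sdiff (hd : 4 ≤ d) (hN : N ≠ 0) (hξ : Admissible d N ξ) {t : ℕ}
    (ht : t ∈ T₁ d ∪ T₂ d) : tildeG d N ξ t = G d N (t : ZMod d) \ constPair N ξ := by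
  have hm := half_ne_zero hd
  have hsum := sum_const_admissible hξ
  have h0 := zero_mem_T₁_union_T₂ (d := d)
  have hh := half_mem_T₁_union_T₂ (d := d)
  have hle := le_of_mem_T₁_union_T₂ ht
  ext x
  rw [mem_sdiff, mem_constPair, mem_G hN]
  unfold tildeG
  by_cases ht0 : t = 0
  · subst ht0
    rw [if_pos rfl]
    split_ifs with hc
    · rw [mem_sdiff, mem_G hN, mem_singleton, Nat.cast_zero, not_or]
      rw [if_pos hc] at hsum
      refine and_congr_right fun hx => ⟨fun h => ⟨h, ?_⟩, fun h => h.1⟩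
      rintro rfl
      exact hm (hsum ▸ hx)
    · simp [mem_G hN]
  rw [if_neg ht0]
  have hc0 := natCast_ne_of_mem ht h0 ht0
  rw [Nat.cast_zero] at hc0
  by_cases htm : t = d / 2
  · rw [if_pos htm]
    subst htm
    split_ifs with hc
    · rw [mem_sdiff, mem_G hN, mem_singleton, not_or]
      refine and_congr_right fun hx => ⟨fun h => ⟨?_, h⟩, fun h => h.2⟩
      rintro rfl
      exact hc0 (by rw [← hx]; simp)
    · rw [mem_G hN]
      rw [if_neg hc] at hsum
      refine ⟨fun hx => ⟨hx, ?_⟩, fun h => h.1⟩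
      rintro (rfl | rfl)
      · exact hc0 (by rw [← hx]; simp)
      · exact hc0 (by rw [← hx, hsum])
  rw [if_neg htm, if_neg (by omega), mem_G hN]
  have hcm := natCast_ne_of_mem ht hh htm
  refine ⟨fun hx => ⟨hx, ?_⟩, fun h => h.1⟩
  rintro (rfl | rfl)
  · exact hc0 (by rw [← hx]; simp)
  · rw [hsum] at hx
    split_ifs at hx
    · exact hcm hx.symm
    · exact hc0 hx.symm

theorem tildeG_half_add_one (hd : 4 ≤ d) : tildeG d N ξ (d / 2 + 1) = constPair N ξ := by
  unfold tildeG
  rw [if_neg (by omega), if_neg (by omega), if_pos rfl, constPair]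

theorem mem_tildeG (hd : 4 ≤ d) (hN : N ≠ 0) (hξ : Admissible d N ξ) {t : ℕ}
    (ht : t ∈ T₁ d ∪ T₂ d) {x : Str d N} :
    x ∈ tildeG d N ξ t ↔ ∑ j, x j = t ∧ x ∉ constPair N ξ := by
  rw [tildeG_eq_sdiff hd hN hξ ht, mem_sdiff, mem_G hN]

theorem disjoint_tildeG (hd : 4 ≤ d) (hN : N ≠ 0) (hξ : Admissible d N ξ) {s t : ℕ}
    (hs : s ∈ T₃ d) (ht : t ∈ T₃ d) (h : s ≠ t) :
    Disjoint (tildeG d N ξ s) (tildeG d N ξ t) := by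
  rw [disjoint_left]
  intro x hxs hxt
  rcases mem_T₃.mp hs with hs | rfl <;> rcases mem_T₃.mp ht with ht | rfl
  · rw [mem_tildeG hd hN hξ hs] at hxs
    rw [mem_tildeG hd hN hξ ht] at hxt
    exact natCast_ne_of_mem hs ht h (hxs.1.symm.trans hxt.1)
  · rw [mem_tildeG hd hN hξ hs] at hxs
    rw [tildeG_half_add_one hd] at hxt
    exact hxs.2 hxt
  · rw [mem_tildeG hd hN hξ ht] at hxt
    rw [tildeG_half_add_one hd] at hxs
    exact hxt.2 hxs
  · exact h rfl

/-- Every string with coordinate sum in `T₁ ∪ T₂` lies in one of the modified sets. -/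
theorem exists_mem_tildeG (hd : 4 ≤ d) (hN : N ≠ 0) (hξ : Admissible d N ξ) {t : ℕ}
    (ht : t ∈ T₁ d ∪ T₂ d) {x : Str d N} (hx : ∑ j, x j = t) :
    (x ∉ constPair N ξ ∧ x ∈ tildeG d N ξ t) ∨
      (x ∈ constPair N ξ ∧ x ∈ tildeG d N ξ (d / 2 + 1)) := by
  rw [tildeG_half_add_one hd, mem_tildeG hd hN hξ ht]
  tauto

theorem sum_card_tildeG (hd : 4 ≤ d) (hN : N ≠ 0) (hξ : Admissible d N ξ) :
    ∑ t ∈ T₃ d, (tildeG d N ξ t).card = (d / 2 / 2 + 2) * d ^ (N - 1) := by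
  classical
  rw [← card_biUnion fun s hs t ht h => disjoint_tildeG hd hN hξ hs ht h]
  have e : (T₃ d).biUnion (tildeG d N ξ) = (T₁ d ∪ T₂ d).biUnion fun t => G d N (t : ZMod d) := by
    ext x
    simp only [mem_biUnion, mem_G hN]
    constructor
    · rintro ⟨t, ht, hx⟩
      rcases mem_T₃.mp ht with ht | rfl
      · exact ⟨t, ht, ((mem_tildeG hd hN hξ ht).mp hx).1⟩
      · rw [tildeG_half_add_one hd, mem_constPair] at hx
        rcases hx with rfl | rfl
        · exact ⟨0, zero_mem_T₁_union_T₂, by simp⟩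
        · rw [sum_const_admissible hξ]
          split_ifs
          · exact ⟨d / 2, half_mem_T₁_union_T₂, rfl⟩
          · exact ⟨0, zero_mem_T₁_union_T₂, by simp⟩
    · rintro ⟨t, ht, hx⟩
      rcases exists_mem_tildeG hd hN hξ ht hx with h | h
      · exact ⟨t, mem_T₃.mpr (.inl ht), h.2⟩
      · exact ⟨d / 2 + 1, mem_T₃.mpr (.inr rfl), h.2⟩
  rw [e, card_biUnion]
  · simp only [card_G hN, sum_const, smul_eq_mul, card_T₁_union_T₂ hd]
  · intro s hs t ht h
    rw [Function.onFun, disjoint_left]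
    intro x h1 h2
    rw [mem_G hN] at h1 h2
    exact natCast_ne_of_mem hs ht h (h1.symm.trans h2)

end Combinatorics

/-! ### Orthogonality and cardinality -/

variable {d N : ℕ} [NeZero d] {ξ : ZMod d}

theorem inner_fourierState_tildeG (hd : 4 ≤ d) (hN : N ≠ 0) (hξ : Admissible d N ξ)
    (f : ∀ t : T₃ d, tildeG d N ξ t ≃ Fin (tildeG d N ξ t).card)
    (p q : Σ t : T₃ d, Fin (tildeG d N ξ t).card) (h : p ≠ q) :
    inner ℂ (fourierState _ (f p.1) p.2) (fourierState _ (f q.1) q.2) = 0 := by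
  obtain ⟨s, k⟩ := p
  obtain ⟨t, l⟩ := q
  by_cases hst : s = t
  · subst hst
    exact inner_fourierState_of_ne _ _ fun e => h (congrArg (Sigma.mk s) e)
  · exact inner_fourierState_of_disjoint
      (disjoint_tildeG hd hN hξ s.2 t.2 fun e => hst (Subtype.ext e)) _ _ _ _

/-- Coinciding states with different indices would be orthogonal to themselves, hence zero. -/
theorem fourierState_tildeG_injective (hd : 4 ≤ d) (hN : N ≠ 0) (hξ : Admissible d N ξ)
    (f : ∀ t : T₃ d, tildeG d N ξ t ≃ Fin (tildeG d N ξ t).card) :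
    Function.Injective fun p : Σ t : T₃ d, Fin (tildeG d N ξ t).card =>
      fourierState _ (f p.1) p.2 := by
  intro p q h
  by_contra hpq
  have h0 := inner_fourierState_tildeG hd hN hξ f p q hpq
  dsimp only at h
  rw [← h] at h0
  exact fourierState_ne_zero _ _ (inner_self_eq_zero.mp h0)

theorem tildeS_eq_range (f : ∀ t : T₃ d, tildeG d N ξ t ≃ Fin (tildeG d N ξ t).card) :
    tildeS ξ f = Set.range fun p : Σ t : T₃ d, Fin (tildeG d N ξ t).card =>
      fourierState _ (f p.1) p.2 := by
  ext ψ
  simp [tildeS, tildeSBlock]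

theorem ncard_tildeS (hd : 4 ≤ d) (hN : N ≠ 0) (hξ : Admissible d N ξ)
    (f : ∀ t : T₃ d, tildeG d N ξ t ≃ Fin (tildeG d N ξ t).card) :
    (tildeS ξ f).ncard = (d / 2 / 2 + 2) * d ^ (N - 1) := by
  rw [tildeS_eq_range, ← Nat.card_coe_set_eq,
    Nat.card_range_of_injective (fourierState_tildeG_injective hd hN hξ f),
    Nat.card_eq_fintype_card, Fintype.card_sigma, ← sum_card_tildeG hd hN hξ]
  simp only [Fintype.card_fin]
  exact sum_coe_sort (T₃ d) fun t => (tildeG d N ξ t).card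

theorem pairwise_inner_tildeS (hd : 4 ≤ d) (hN : N ≠ 0) (hξ : Admissible d N ξ)
    (f : ∀ t : T₃ d, tildeG d N ξ t ≃ Fin (tildeG d N ξ t).card) :
    (tildeS ξ f).Pairwise fun φ ψ => inner ℂ φ ψ = 0 := by
  rw [tildeS_eq_range]
  rintro _ ⟨p, rfl⟩ _ ⟨q, rfl⟩ h
  exact inner_fourierState_tildeG hd hN hξ f p q fun e => h (by rw [e])

/-! ### Genuine entanglement -/

/-- The string that agrees with `x` on `A` and with `y` off `A`. -/
def mix (A : Finset (Fin N)) (x y : Str d N) : Str d N := fun i => if i ∈ A then x i else y i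

omit [NeZero d] in
/-- The support of a product state is closed under mixing. -/
theorem IsProductAcross.mix_ne_zero {A : Finset (Fin N)} {ψ : Hilb d N}
    (h : IsProductAcross A ψ) {x y : Str d N} (hx : ψ x ≠ 0) (hy : ψ y ≠ 0) :
    ψ (mix A x y) ≠ 0 := by
  obtain ⟨α, β, hαβ⟩ := h
  rw [hαβ] at hx hy ⊢
  have e1 : (fun i : A => mix A x y i) = fun i : A => x i := by
    funext i; simp [mix]
  have e2 : (fun i : {i // i ∉ A} => mix A x y i) = fun i : {i // i ∉ A} => y i := by
    funext i; simp [mix, i.2]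
  rw [e1, e2]
  exact mul_ne_zero (left_ne_zero_of_mul hx) (right_ne_zero_of_mul hy)

omit [NeZero d] in
theorem sum_mix (A : Finset (Fin N)) (x y : Str d N) :
    ∑ i, mix A x y i = ∑ i ∈ A, x i + ∑ i ∈ Aᶜ, y i := by
  rw [← sum_add_sum_compl A]
  congr 1
  · exact sum_congr rfl fun i hi => by simp [mix, hi]
  · exact sum_congr rfl fun i hi => by simp [mix, mem_compl.mp hi]

/-- The strings over `t` minus at most two strings still take two different partial sums. -/
theorem exists_partial_sum_ne (hd : 4 ≤ d) {A : Finset (Fin N)} {i j : Fin N} (hi : i ∈ A)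
    (hj : j ∉ A) (t : ZMod d) (R : Finset (Str d N)) (hR : R.card ≤ 2) :
    ∃ x y : Str d N, ∑ k, x k = t ∧ x ∉ R ∧ ∑ k, y k = t ∧ y ∉ R ∧
      ∑ k ∈ A, x k ≠ ∑ k ∈ A, y k := by
  classical
  -- These `d ≥ 4` strings have sum `t` and distinct partial sums `c` over `A`; at least two of them
  -- avoid `R`.
  let g : ZMod d → Str d N := fun c => Pi.single i c + Pi.single j (t - c)
  have hij : i ≠ j := fun e => hj (e ▸ hi)
  have hgA : ∀ c, ∑ k ∈ A, g c k = c := by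
    intro c
    simp [g, sum_add_distrib, Pi.single_apply, hi, hj]
  have hg : ∀ c, ∑ k, g c k = t := by
    intro c
    simp [g, sum_add_distrib, Pi.single_apply]
  have hinj : Function.Injective g := fun c c' h => by rw [← hgA c, h, hgA]
  have hcard : 1 < (univ.filter fun c => g c ∉ R).card := by
    have h1 : (univ.filter fun c => g c ∈ R).card ≤ R.card :=
      card_le_card_of_injOn g (fun c hc => by simpa using hc) hinj.injOn
    have h2 := card_filter_add_card_filter_not (s := (univ : Finset (ZMod d))) (fun c => g c ∈ R)
    rw [card_univ, ZMod.card] at h2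
    omega
  obtain ⟨c, hc, c', hc', hne⟩ := one_lt_card.mp hcard
  refine ⟨g c, g c', hg c, (mem_filter.mp hc).2, hg c', (mem_filter.mp hc').2, ?_⟩
  rwa [hgA, hgA]

omit [NeZero d] in
theorem card_constPair_le (N : ℕ) (ξ : ZMod d) : (constPair N ξ).card ≤ 2 := card_le_two

theorem isGenuinelyEntangled_fourierState (hd : 4 ≤ d) (hN : N ≠ 0) (hξ : Admissible d N ξ)
    {t : ℕ} (ht : t ∈ T₃ d) (f : tildeG d N ξ t ≃ Fin (tildeG d N ξ t).card)
    (k : Fin (tildeG d N ξ t).card) : IsGenuinelyEntangled (fourierState _ f k) := by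
  refine ⟨fourierState_ne_zero f k, fun A hA hA' hprod => ?_⟩
  obtain ⟨i, hi⟩ := hA
  obtain ⟨j, hj⟩ : ∃ j, j ∉ A := by
    by_contra! h
    exact hA' (eq_univ_iff_forall.mpr h)
  have hmix : ∀ x ∈ tildeG d N ξ t, ∀ y ∈ tildeG d N ξ t, mix A x y ∈ tildeG d N ξ t := by
    intro x hx y hy
    rw [← fourierState_apply_ne_zero_iff f k] at hx hy ⊢
    exact hprod.mix_ne_zero hx hy
  rcases mem_T₃.mp ht with ht | rfl
  · obtain ⟨x, y, hx, hxR, hy, hyR, hne⟩ :=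
      exists_partial_sum_ne hd hi hj (t : ZMod d) _ (card_constPair_le N ξ)
    have h := hmix x ((mem_tildeG hd hN hξ ht).mpr ⟨hx, hxR⟩) y
      ((mem_tildeG hd hN hξ ht).mpr ⟨hy, hyR⟩)
    -- The mixed string shares the part of `y` off `A`, so it has sum `t` only if the partial sums
    -- over `A` agree.
    rw [mem_tildeG hd hN hξ ht, sum_mix, ← hy, ← sum_add_sum_compl A y] at h
    exact hne (add_right_cancel h.1)
  · rw [tildeG_half_add_one hd] at hmix
    have h := hmix (fun _ => 0) (by simp [mem_constPair]) (fun _ => ξ) (by simp [mem_constPair])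
    rw [mem_constPair] at h
    rcases h with h | h
    · have := congrFun h j
      simp only [mix, hj, if_false] at this
      exact hξ.1 this
    · have := congrFun h i
      simp only [mix, hi, if_true] at this
      exact hξ.1 this.symm

theorem isOGES_tildeS (hd : 4 ≤ d) (hN : N ≠ 0) (hξ : Admissible d N ξ)
    (f : ∀ t : T₃ d, tildeG d N ξ t ≃ Fin (tildeG d N ξ t).card) : IsOGES (tildeS ξ f) := by
  refine ⟨?_, pairwise_inner_tildeS hd hN hξ f⟩
  rw [tildeS_eq_range]
  rintro _ ⟨p, rfl⟩
  exact isGenuinelyEntangled_fourierState hd hN hξ p.1.2 _ _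

/-! ### Strongest nonlocality -/

/-- The string that equals `a` on `A`, `v` at `j`, and `0` elsewhere. -/
def extend {A : Finset (Fin N)} (j : Fin N) (a : A → ZMod d) (v : ZMod d) : Str d N :=
  fun i => if h : i ∈ A then a ⟨i, h⟩ else if i = j then v else 0

section Extend

variable {A : Finset (Fin N)} {j : Fin N}

omit [NeZero d] in
theorem extend_apply_coe (a : A → ZMod d) (v : ZMod d) (i : A) : extend j a v i = a i := by
  simp [extend]

omit [NeZero d] in
theorem extend_apply_self (hj : j ∉ A) (a : A → ZMod d) (v : ZMod d) : extend j a v j = v := by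
  simp [extend, hj]

omit [NeZero d] in
theorem sum_extend (hj : j ∉ A) (a : A → ZMod d) (v : ZMod d) :
    ∑ i, extend j a v i = ∑ i, a i + v := by
  rw [← sum_add_sum_compl A]
  congr 1
  · rw [← sum_coe_sort A]
    exact sum_congr rfl fun i _ => extend_apply_coe a v i
  · rw [sum_eq_single j]
    · exact extend_apply_self hj a v
    · intro i hi hij
      simp [extend, mem_compl.mp hi, hij]
    · intro h
      exact absurd (mem_compl.mpr hj) h

omit [NeZero d] in
theorem extend_injective (v : ZMod d) : Function.Injective fun a : A → ZMod d => extend j a v := by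
  intro a b h
  funext i
  rw [← extend_apply_coe (j := j) a v, ← extend_apply_coe (j := j) b v]
  exact congrFun h i

omit [NeZero d] in
theorem localOp_extend (E : Matrix (A → ZMod d) (A → ZMod d) ℂ) (a b : A → ZMod d) (v : ZMod d) :
    localOp A E (extend j a v) (extend j b v) = E a b := by
  rw [localOp, Matrix.of_apply, if_pos]
  · simp only [extend_apply_coe]
  · intro i hi
    simp [extend, hi]

end Extend

/-- An operator on `A` that preserves the orthogonality of the set `tildeS` is a scalar. -/
theorem eq_scalar_of_preserves (hd : 4 ≤ d) (hN : N ≠ 0) (hξ : Admissible d N ξ)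
    (f : ∀ t : T₃ d, tildeG d N ξ t ≃ Fin (tildeG d N ξ t).card) {A : Finset (Fin N)}
    (hA : A ≠ univ) (E : Matrix (A → ZMod d) (A → ZMod d) ℂ)
    (hE : ∀ φ ∈ tildeS ξ f, ∀ ψ ∈ tildeS ξ f, φ ≠ ψ →
      inner ℂ φ (Matrix.toEuclideanLin (localOp A E) ψ) = 0) :
    ∃ c : ℂ, E = c • (1 : Matrix (A → ZMod d) (A → ZMod d) ℂ) := by
  classical
  obtain ⟨j, hj⟩ : ∃ j, j ∉ A := by
    by_contra! h
    exact hA (eq_univ_iff_forall.mpr h)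
  have hinner : ∀ p q : Σ t : T₃ d, Fin (tildeG d N ξ t).card, p ≠ q →
      inner ℂ (fourierState _ (f p.1) p.2)
        (Matrix.toEuclideanLin (localOp A E) (fourierState _ (f q.1) q.2)) = 0 := by
    intro p q hpq
    rw [tildeS_eq_range] at hE
    exact hE _ ⟨p, rfl⟩ _ ⟨q, rfl⟩ fun e => hpq (fourierState_tildeG_injective hd hN hξ f e)
  have hcross : ∀ s ∈ T₃ d, ∀ t ∈ T₃ d, s ≠ t → ∀ x ∈ tildeG d N ξ s, ∀ y ∈ tildeG d N ξ t,
      localOp A E x y = 0 := by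
    intro s hs t ht hst x hx y hy
    refine apply_eq_zero_of_inner_fourierState (f ⟨s, hs⟩) (f ⟨t, ht⟩) (fun k l => ?_) hx hy
    refine hinner ⟨⟨s, hs⟩, k⟩ ⟨⟨t, ht⟩, l⟩ fun e => hst ?_
    exact congrArg (fun p => (p.1 : ℕ)) e
  have hlast : d / 2 + 1 ∈ T₃ d := mem_T₃.mpr (.inr rfl)
  have hne_last : ∀ t ∈ T₁ d ∪ T₂ d, t ≠ d / 2 + 1 := fun t ht => by
    have := le_of_mem_T₁_union_T₂ ht
    omega
  have hsum : ∀ a b : A → ZMod d, ∑ i, a i ≠ ∑ i, b i → E a b = 0 := by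
    intro a b hab
    obtain ⟨s, hs, t, ht, hst, hδ⟩ := exists_difference (sub_ne_zero.mpr hab)
    have hs3 := mem_T₃.mpr (.inl hs)
    have ht3 := mem_T₃.mpr (.inl ht)
    -- The same `v` gives the extension of `a` the sum `s` and that of `b` the sum `t`, because `s -
    -- t` is the difference of the partial sums.
    set v : ZMod d := s - ∑ i, a i with hv
    have hxa : ∑ i, extend j a v i = s := by rw [sum_extend hj, hv]; ring
    have hxb : ∑ i, extend j b v i = t := by
      rw [sum_extend hj, hv]
      linear_combination hδ
    rw [← localOp_extend (j := j) E a b v]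
    rcases exists_mem_tildeG hd hN hξ hs hxa with ⟨h1, h1'⟩ | ⟨h1, h1'⟩ <;>
      rcases exists_mem_tildeG hd hN hξ ht hxb with ⟨h2, h2'⟩ | ⟨h2, h2'⟩
    · exact hcross s hs3 t ht3 hst _ h1' _ h2'
    · exact hcross s hs3 _ hlast (hne_last s hs) _ h1' _ h2'
    · exact hcross _ hlast t ht3 (hne_last t ht).symm _ h1' _ h2'
    -- Two strings of the constant pair that share the entry `v` at `j` coincide, which would force
    -- `a = b`.
    · exfalso
      have key : ∀ a : A → ZMod d, extend j a v ∈ constPair N ξ →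
          extend j a v = fun _ => v := by
        intro a h
        rcases mem_constPair.mp h with h | h <;>
        · have e := congrFun h j
          rw [extend_apply_self hj] at e
          rw [h, e]
      have := extend_injective (j := j) v ((key a h1).trans (key b h2).symm)
      exact hab (by rw [this])
  have h0T := zero_mem_T₁_union_T₂ (d := d)
  -- For `b` of sum zero, extension by zeros sends `0` to `0^N` in the constant pair, but keeps `b`
  -- in the sum-zero class: its entry `0` at `j` rules out `ξ^N`.
  have hrow : ∀ b : A → ZMod d, b ≠ 0 → E 0 b = 0 := by
    intro b hb
    by_cases hb0 : ∑ i, b i = 0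
    · rw [← localOp_extend (j := j) E 0 b 0]
      have hz : extend j (0 : A → ZMod d) 0 = fun _ => 0 := by
        funext i
        simp [extend]
      refine hcross _ hlast 0 (mem_T₃.mpr (.inl h0T)) (by omega) _ ?_ _ ?_
      · rw [tildeG_half_add_one hd, mem_constPair]
        exact .inl hz
      · rw [mem_tildeG hd hN hξ h0T, sum_extend hj, hb0, mem_constPair]
        refine ⟨by simp, ?_⟩
        rintro (h | h)
        · exact hb (extend_injective (j := j) 0 (h.trans hz.symm))
        · have := congrFun h j
          rw [extend_apply_self hj] at this
          exact hξ.1 this.symm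
    · exact hsum 0 b fun e => hb0 (by rw [← e]; simp)
  -- Since `1 < d / 2`, the sum `1` differs from the sums of both constants, so the class of `1`
  -- loses no string.
  have h1T : 1 ∈ T₁ d ∪ T₂ d := by
    rw [mem_T₁_union_T₂]
    exact .inl ⟨by omega, odd_one⟩
  have h1T3 := mem_T₃.mpr (.inl h1T)
  have hmem : ∀ x : Str d N, ∑ i, x i = 1 → x ∈ tildeG d N ξ 1 := by
    intro x hx
    rcases exists_mem_tildeG hd hN hξ h1T (x := x) (by simpa using hx) with h | h
    · exact h.2
    · exfalso
      have hhT := half_mem_T₁_union_T₂ (d := d)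
      have n0 := natCast_ne_of_mem h1T h0T one_ne_zero
      have nh := natCast_ne_of_mem h1T hhT (by omega)
      rcases mem_constPair.mp h.1 with rfl | rfl
      · exact n0 (by simpa using hx.symm)
      · rw [sum_const_admissible hξ] at hx
        split_ifs at hx
        · exact nh (by simpa using hx.symm)
        · exact n0 (by simpa using hx.symm)
  have hz : extend j (0 : A → ZMod d) 1 ∈ tildeG d N ξ 1 :=
    hmem _ (by rw [sum_extend hj]; simp)
  -- This row inherits its diagonality from the zero row of `E`: entries with `y` differing off `A`
  -- vanish by the form of `E ⊗ 𝟙`.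
  have hzrow : ∀ y, y ≠ extend j (0 : A → ZMod d) 1 →
      localOp A E (extend j (0 : A → ZMod d) 1) y = 0 := by
    intro y hy
    rw [localOp, Matrix.of_apply]
    split_ifs with h
    · simp only [extend_apply_coe]
      refine hrow _ fun e => hy ?_
      funext i
      by_cases hi : i ∈ A
      · have := congrFun e ⟨i, hi⟩
        simpa [extend, hi] using this
      · exact (h i hi).symm
    · rfl
  have hblock : ∀ x ∈ tildeG d N ξ 1, ∀ y ∈ tildeG d N ξ 1, localOp A E x y =
      if x = y then localOp A E (extend j (0 : A → ZMod d) 1) (extend j (0 : A → ZMod d) 1) else 0 := by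
    intro x hx y hy
    refine apply_eq_scalar_of_inner_fourierState (f ⟨1, h1T3⟩) (fun k l hkl => ?_) hz hzrow hx hy
    refine hinner ⟨⟨1, h1T3⟩, k⟩ ⟨⟨1, h1T3⟩, l⟩ fun e => hkl ?_
    simpa using e
  refine ⟨E 0 0, ?_⟩
  ext a b
  rw [Matrix.smul_apply, Matrix.one_apply]
  by_cases hab : ∑ i, a i = ∑ i, b i
  · have h := hblock (extend j a (1 - ∑ i, a i)) (hmem _ (by rw [sum_extend hj]; ring))
      (extend j b (1 - ∑ i, a i)) (hmem _ (by rw [sum_extend hj, hab]; ring))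
    rw [localOp_extend, localOp_extend] at h
    simp only [(extend_injective (j := j) _).eq_iff] at h
    rw [h]
    split_ifs <;> simp
  · rw [hsum a b hab, if_neg fun e => hab (by rw [e]), smul_zero]

end OGES

theorem theorem5 (d N : ℕ) [NeZero d] (hd : 4 ≤ d) (hN : 2 ≤ N) :
    (∃ ξ : ZMod d, OGES.Admissible d N ξ) ∧
    ∀ ξ : ZMod d, OGES.Admissible d N ξ →
      ∀ f : (∀ t : OGES.T₃ d, OGES.tildeG d N ξ t ≃ Fin (OGES.tildeG d N ξ t).card),
        OGES.IsOGES (OGES.tildeS ξ f) ∧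
        OGES.HasStrongestNonlocality (OGES.tildeS ξ f) ∧
        (Odd (d / 2) →
          (OGES.tildeS ξ f).ncard = ((d / 2 + 1) / 2 + 1) * d ^ (N - 1)) ∧
        (Even (d / 2) →
          (OGES.tildeS ξ f).ncard = (d / 2 / 2 + 2) * d ^ (N - 1)) := by
  have hN0 : N ≠ 0 := by omega
  refine ⟨OGES.exists_admissible hd, fun ξ hξ f => ⟨OGES.isOGES_tildeS hd hN0 hξ f, ?_, ?_, ?_⟩⟩
  · intro A _ hA n E _ hE m
    exact OGES.eq_scalar_of_preserves hd hN0 hξ f hA (E m) (hE m)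
  · intro hodd
    rw [OGES.ncard_tildeS hd hN0 hξ f]
    -- For odd `m`, `(m + 1) / 2 + 1` equals `m / 2 + 2` with the division rounded down.
    congr 1
    obtain ⟨k, hk⟩ := hodd
    omega
  · intro _
    exact OGES.ncard_tildeS hd hN0 hξ f
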